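/- Let $d\ge 1$ be an integer, $0<\alpha\le 2$ and $\gamma>0$. Consider the following system of particles in $\mathbb R^d$. At time $0$ the particles are located at the atoms of a Poisson point measure on $\mathbb R^d$ with intensity measure $\mu(dx)=\dfrac{dx}{1+|x|^{\gamma}}$. Given this initial configuration, the particles move independently of one another, each according to the standard symmetric $\alpha$-stable Lévy process, that is, the càdlàg process with stationary independent increments whose displacement $\zeta_t$ over a time $t$ satisfies $E\,e^{i\langle \zeta_t,z\rangle}=e^{-t|z|^{\alpha}}$, $z\in\mathbb R^d$. Let $N_t=\sum_i\delta_{x_i(t)}$, where $(x_i(t))_i$ are the positions of the particles at time $t\ge 0$, and write $\langle N_t,\varphi\rangle=\int\varphi\,dN_t=\sum_i\varphi(x_i(t))$. Proposition 2.6. If $\alpha<d$ and $\alpha<\gamma$, then for every real-valued Schwartz function $\varphi\in\mathcal S(\mathbb R^d)$ the expected total occupation time $$E\int_0^\infty\langle N_s,\varphi\rangle\,ds$$ is finite, in the sense of absolute convergence: $$E\int_0^\infty\langle N_s,|\varphi|\rangle\,ds<\infty .$$ In particular, almost surely $\langle N_s,\varphi\rangle$ converges absolutely for almost every $s>0$ and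 is an integrable function of $s\in(0,\infty)$, and $\int_0^\infty\langle N_s,\varphi\rangle\,ds$ is an integrable random variable. -/

import Mathlib

open MeasureTheory ProbabilityTheory Filter Topology Set
open scoped NNReal ENNReal SchwartzMap

noncomputable section

/-- The intensity measure `μ(dx) = dx / (1 + |x|^γ)` on `ℝ^d`. -/
def intensity (d : ℕ) (γ : ℝ) : Measure (EuclideanSpace ℝ (Fin d)) :=
  volume.withDensity fun x => ENNReal.ofReal (1 / (1 + ‖x‖ ^ γ))

/-- `M` is a Poisson point measure (Poisson random measure) with intensity `ν`: the mass of every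
measurable set `B` of finite intensity is a Poisson variable with mean `ν B`, and the masses of
finitely many pairwise disjoint measurable sets are independent. -/
structure IsPoissonPointMeasure {Ω E : Type*} [MeasurableSpace Ω] [MeasurableSpace E]
    (M : Ω → Measure E) (ν : Measure E) (P : Measure Ω) : Prop where
  measurable : Measurable M
  poisson : ∀ B : Set E, MeasurableSet B → ν B ≠ ∞ →
    HasLaw (fun ω => M ω B)
      ((poissonMeasure (ν B).toNNReal).map (fun n : ℕ => (n : ℝ≥0∞))) P
  indep : ∀ (n : ℕ) (B : Fin n → Set E), (∀ i, MeasurableSet (B i)) →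
    Pairwise (fun i j => Disjoint (B i) (B j)) →
    iIndepFun (fun (i : Fin n) (ω : Ω) => M ω (B i)) P

/-- `Z` is a standard symmetric `α`-stable Lévy process in `ℝ^d` started at the origin:
independent stationary increments, càdlàg paths almost surely, and
`E exp(i⟨Z_t, z⟩) = exp(-t |z|^α)`. -/
structure IsStandardStableProcess {Ω : Type*} [MeasurableSpace Ω] {d : ℕ} (α : ℝ)
    (Z : ℝ≥0 → Ω → EuclideanSpace ℝ (Fin d)) (P : Measure Ω) : Prop where
  measurable : ∀ t, Measurable (Z t)
  zero : ∀ᵐ ω ∂P, Z 0 ω = 0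
  indep_increments : HasIndepIncrements Z P
  stationary_increments : ∀ s t : ℝ≥0,
    IdentDistrib (fun ω => Z (s + t) ω - Z s ω) (Z t) P P
  cadlag : ∀ᵐ ω ∂P, ∀ t : ℝ≥0,
    ContinuousWithinAt (fun s => Z s ω) (Ici t) t ∧
      ∃ l, Tendsto (fun s => Z s ω) (𝓝[<] t) (𝓝 l)
  charFun_eq : ∀ (t : ℝ≥0) (z : EuclideanSpace ℝ (Fin d)),
    charFun (P.map (Z t)) z = Complex.exp (-((t : ℂ) * ((‖z‖ ^ α : ℝ) : ℂ)))

/-- The empirical measure `∑_{i < K} δ_{x_i}` of the first `K ≤ ∞` points of a sequence. -/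
def pointSum {E : Type*} [MeasurableSpace E] (K : ℕ∞) (x : ℕ → E) : Measure E :=
  Measure.sum fun i : {i : ℕ // (i : ℕ∞) < K} => Measure.dirac (x i)

/-- The particle system without branching. There are `K ≤ ∞` particles (`K` is random); particle
`i < K` starts at `X i`, and its position at time `t` is `X i + Z i t`. The starting points form a
Poisson point measure with intensity `ν`, the displacements `Z i` are independent standard
`α`-stable processes, and they are independent of the initial configuration. The values `X i` with
`i ≥ K` play no role. -/
structure IsStableParticleSystem {Ω : Type*} [MeasurableSpace Ω] {d : ℕ} (α : ℝ)
    (ν : Measure (EuclideanSpace ℝ (Fin d)))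
    (K : Ω → ℕ∞) (X : ℕ → Ω → EuclideanSpace ℝ (Fin d))
    (Z : ℕ → ℝ≥0 → Ω → EuclideanSpace ℝ (Fin d)) (P : Measure Ω) : Prop where
  measurable_number : Measurable K
  measurable_start : ∀ i, Measurable (X i)
  poisson_start : IsPoissonPointMeasure (fun ω => pointSum (K ω) fun i => X i ω) ν P
  stable : ∀ i, IsStandardStableProcess α (Z i) P
  indep_motions : iIndepFun (fun (i : ℕ) (ω : Ω) (t : ℝ≥0) => Z i t ω) P
  indep_start : IndepFun (fun ω => (K ω, fun i : ℕ => X i ω))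
    (fun (ω : Ω) (i : ℕ) (t : ℝ≥0) => Z i t ω) P

/-- The empirical measure process `N_t = ∑_i δ_{x_i(t)}` of the system, with
`x_i(t) = X i + Z i t`. -/
def empiricalProcess {Ω : Type*} {d : ℕ}
    (K : Ω → ℕ∞) (X : ℕ → Ω → EuclideanSpace ℝ (Fin d))
    (Z : ℕ → ℝ≥0 → Ω → EuclideanSpace ℝ (Fin d)) (t : ℝ≥0) (ω : Ω) :
    Measure (EuclideanSpace ℝ (Fin d)) :=
  pointSum (K ω) fun i => X i ω + Z i t ω

end

/-!
By Campbell's formula and the independence of the motions from the starting points,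
`E ⟨N_s, f⟩ = ∫∫ f (x + z) μ_s(dz) ν(dx)`, where `μ_s` is the law of a stable displacement over
time `s` and `ν` the intensity (`IsStableParticleSystem.lintegral_lintegral`). Exchanging the order
of integration, this is at most `∫ f` times the supremum over `y` of `∫ h (y - z) μ_s(dz)`, with
`h(x) = 1 / (1 + |x|^γ)`, and it remains to show that a bound on this supremum is integrable in `s`.

No stable density is needed for that. The function `h` is dominated by the Gaussian mixture
`C ∫ u^(γ/2 - 1) e^(-u) e^(-u |x|²) du` (`ofReal_one_div_one_add_rpow_le`). Each Gaussian
`e^(-u |w|²)` is the normalized integral of `e^(-|v|²/4) e^(i √u ⟨w, v⟩)` over `v`, so that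
`∫ e^(-u |y - z|²) μ_s(dz)` is at most a multiple of `∫ e^(-|v|²/4) e^(-s u^(α/2) |v|^α) dv`, whatever
`y` is (`lintegral_gaussian_le_charFun`). Integrating over `s` leaves
`u^(-α/2) ∫ e^(-|v|²/4) |v|^(-α) dv`, finite because `α < d`, and the remaining integral
`∫ u^((γ - α)/2 - 1) e^(-u) du` is finite because `α < γ` (`lintegral_occupationBound_lt_top`).

For the measurability claims, right-continuity of the paths makes each `Z i` measurable in time and
chance jointly, up to a null set (`IsStandardStableProcess.aemeasurable_uncurry`). With that, `⟨N_s, φ⟩`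
is integrable on the product of the probability space with `(0, ∞)`, and Fubini's theorem gives the
almost sure statements.
-/

open MeasureTheory ProbabilityTheory Filter Topology Set
open scoped NNReal ENNReal SchwartzMap

/-! ### Gaussian functions and characteristic functions -/

section Gaussian

variable {E : Type*} [NormedAddCommGroup E] [InnerProductSpace ℝ E] [FiniteDimensional ℝ E]
  [MeasurableSpace E] [BorelSpace E]

theorem integrable_exp_neg_quarter_norm_sq :
    Integrable (fun v : E => Real.exp (-‖v‖ ^ 2 / 4)) := by
  have h := (GaussianFourier.integrable_cexp_neg_mul_sq_norm_add (V := E) (b := 1 / 4)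
    (by norm_num) 0 0).norm
  refine h.congr (.of_forall fun v => ?_)
  simp only [Complex.norm_exp]
  congr 1
  have : (-(1 / 4 : ℂ) * (‖v‖ : ℂ) ^ 2 + 0 * (inner ℝ (0 : E) v : ℝ)) =
      ((-‖v‖ ^ 2 / 4 : ℝ) : ℂ) := by push_cast; ring
  rw [this, Complex.ofReal_re]

/-- The Gaussian `w ↦ exp (-u |w|²)` is, up to normalization, the Fourier transform at `√u • w` of
the fixed Gaussian `v ↦ exp (-|v|² / 4)`. -/
theorem integral_gaussian_mul_cexp_inner {u : ℝ} (hu : 0 ≤ u) (w : E) :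
    ∫ v : E, (Real.exp (-‖v‖ ^ 2 / 4) : ℂ) * Complex.exp ((inner ℝ w (√u • v) : ℝ) * Complex.I) =
      ((∫ v : E, Real.exp (-‖v‖ ^ 2 / 4) : ℝ) : ℂ) * Real.exp (-u * ‖w‖ ^ 2) := by
  have h1 := GaussianFourier.integral_cexp_neg_mul_sq_norm_add (V := E) (b := 1 / 4)
    (by norm_num) (Complex.I * √u) w
  have h2 := GaussianFourier.integral_cexp_neg_mul_sq_norm (V := E) (b := 1 / 4) (by norm_num)
  rw [← h2] at h1
  have hsq : ((√u : ℝ) : ℂ) ^ 2 = u := by rw [← Complex.ofReal_pow, Real.sq_sqrt hu]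
  rw [← integral_complex_ofReal]
  convert h1 using 1
  · refine integral_congr_ae (.of_forall fun v => ?_)
    simp only [Complex.ofReal_exp, ← Complex.exp_add, inner_smul_right]
    congr 1
    push_cast
    ring
  · congr 1
    · refine integral_congr_ae (.of_forall fun v => ?_)
      simp only [Complex.ofReal_exp]
      congr 1
      push_cast
      ring
    · rw [Complex.ofReal_exp]
      congr 1
      rw [mul_pow, hsq, Complex.I_sq]
      push_cast
      ring

theorem integral_exp_neg_quarter_norm_sq_pos :
    0 < ∫ v : E, Real.exp (-‖v‖ ^ 2 / 4) := by
  have h := GaussianFourier.integral_rexp_neg_mul_sq_norm (V := E) (b := 1 / 4) (by norm_num)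
  have h' : ∫ v : E, Real.exp (-‖v‖ ^ 2 / 4) = ∫ v : E, Real.exp (-(1 / 4) * ‖v‖ ^ 2) :=
    integral_congr_ae (.of_forall fun v => by simp only; congr 1; ring)
  rw [h', h]
  positivity

/-- A Parseval bound: the integral of a Gaussian centred at `y` against `μ` is a Gaussian integral of
`charFun μ` with phases depending on `y`, and is at most what it becomes when the phases are dropped;
the bound does not depend on `y`. -/
theorem lintegral_gaussian_le_charFun (μ : Measure E) [IsProbabilityMeasure μ] {u : ℝ}
    (hu : 0 ≤ u) (y : E) :
    ENNReal.ofReal (∫ v : E, Real.exp (-‖v‖ ^ 2 / 4)) *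
        ∫⁻ z, ENNReal.ofReal (Real.exp (-u * ‖y - z‖ ^ 2)) ∂μ ≤
      ∫⁻ v : E, ENNReal.ofReal (Real.exp (-‖v‖ ^ 2 / 4)) * ‖charFun μ (-(√u • v))‖ₑ := by
  set c : ℝ := ∫ v : E, Real.exp (-‖v‖ ^ 2 / 4) with hc
  have hc0 : 0 < c := integral_exp_neg_quarter_norm_sq_pos
  let F : E → E → ℂ := fun z v =>
    (Real.exp (-‖v‖ ^ 2 / 4) : ℂ) * Complex.exp ((inner ℝ (y - z) (√u • v) : ℝ) * Complex.I)
  have hFn : ∀ p : E × E, ‖F p.1 p.2‖ = Real.exp (-‖p.2‖ ^ 2 / 4) := fun p => by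
    simp only [F, norm_mul, Complex.norm_exp_ofReal_mul_I, mul_one, Complex.norm_real,
      Real.norm_eq_abs, abs_of_pos (Real.exp_pos _)]
  have hF : Integrable (Function.uncurry F) (μ.prod volume) := by
    have hb : Integrable (fun p : E × E => Real.exp (-‖p.2‖ ^ 2 / 4)) (μ.prod volume) :=
      (integrable_exp_neg_quarter_norm_sq (E := E)).comp_snd μ
    refine hb.mono' ?_ (.of_forall fun p => (hFn p).le)
    refine Continuous.aestronglyMeasurable ?_
    simp only [F, Function.uncurry_def]
    fun_prop
  have hint : Integrable (fun z => Real.exp (-u * ‖y - z‖ ^ 2)) μ := by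
    refine (integrable_const (1 : ℝ)).mono' (by fun_prop) (.of_forall fun z => ?_)
    rw [Real.norm_eq_abs, abs_of_pos (Real.exp_pos _), Real.exp_le_one_iff]
    nlinarith [sq_nonneg ‖y - z‖]
  have hswap := integral_integral_swap hF
  have hleft : ∫ z, (∫ v, F z v) ∂μ = ((c * ∫ z, Real.exp (-u * ‖y - z‖ ^ 2) ∂μ : ℝ) : ℂ) := by
    simp only [F, integral_gaussian_mul_cexp_inner hu]
    rw [integral_const_mul, integral_complex_ofReal, ← hc]
    push_cast
    rfl
  have hright : ∀ v, ∫ z, F z v ∂μ = (Real.exp (-‖v‖ ^ 2 / 4) : ℂ) *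
      (Complex.exp ((inner ℝ y (√u • v) : ℝ) * Complex.I) * charFun μ (-(√u • v))) := fun v => by
    simp only [F, charFun_apply]
    rw [integral_const_mul, ← integral_const_mul (Complex.exp _)]
    congr 1
    refine integral_congr_ae (.of_forall fun z => ?_)
    simp only [← Complex.exp_add, inner_sub_left, inner_neg_right]
    congr 1
    push_cast
    ring
  rw [hleft] at hswap
  rw [← ofReal_integral_eq_lintegral_ofReal hint (.of_forall fun z => (Real.exp_pos _).le),
    ← ENNReal.ofReal_mul hc0.le]
  have hnn : 0 ≤ c * ∫ z, Real.exp (-u * ‖y - z‖ ^ 2) ∂μ :=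
    mul_nonneg hc0.le (integral_nonneg fun z => (Real.exp_pos _).le)
  calc ENNReal.ofReal (c * ∫ z, Real.exp (-u * ‖y - z‖ ^ 2) ∂μ)
      = ‖∫ v, ∫ z, F z v ∂μ‖ₑ := by
        rw [← hswap, ← ofReal_norm, Complex.norm_real, Real.norm_of_nonneg hnn]
    _ ≤ ∫⁻ v, ‖∫ z, F z v ∂μ‖ₑ := enorm_integral_le_lintegral_enorm _
    _ = _ := by
        refine lintegral_congr fun v => ?_
        rw [hright, enorm_mul, enorm_mul]
        congr 1
        · rw [← ofReal_norm, Complex.norm_real,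
            Real.norm_of_nonneg (Real.exp_pos _).le]
        · rw [← ofReal_norm, Complex.norm_exp_ofReal_mul_I, ENNReal.ofReal_one, one_mul]

/-- The singularity `|v|^(-α)` is integrable at the origin because `α` is below the dimension. -/
theorem lintegral_gaussian_mul_norm_rpow_neg_lt_top [Nontrivial E] {α : ℝ}
    (hα : α < Module.finrank ℝ E) :
    ∫⁻ v : E, ENNReal.ofReal (Real.exp (-‖v‖ ^ 2 / 4) * ‖v‖ ^ (-α)) < ∞ := by
  have hd : 0 < Module.finrank ℝ E := Module.finrank_pos
  have h : Integrable (fun v : E => Real.exp (-‖v‖ ^ 2 / 4) * ‖v‖ ^ (-α)) := by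
    refine (integrable_fun_norm_addHaar (volume : Measure E)
      (f := fun r : ℝ => Real.exp (-r ^ 2 / 4) * r ^ (-α))).2 ?_
    refine (integrableOn_rpow_mul_exp_neg_mul_sq (b := 1 / 4) (by norm_num)
      (s := Module.finrank ℝ E - 1 - α) (by linarith)).congr_fun (fun r hr => ?_) measurableSet_Ioi
    simp only [smul_eq_mul]
    have hr0 : (0 : ℝ) < r := hr
    rw [sub_eq_add_neg, Real.rpow_add hr0, ← Nat.cast_pred hd, Real.rpow_natCast]
    rw [show -(1 / 4) * r ^ 2 = -r ^ 2 / 4 by ring]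
    ring
  exact (hasFiniteIntegral_iff_ofReal (.of_forall fun v => by positivity)).1 h.2

end Gaussian

/-! ### Integrals in time and the intensity as a Gaussian mixture -/

theorem lintegral_exp_neg_mul_Ioi {c : ℝ} (hc : 0 < c) :
    ∫⁻ s in Ioi (0 : ℝ), ENNReal.ofReal (Real.exp (-(s * c))) = ENNReal.ofReal c⁻¹ := by
  have h := integral_exp_mul_Ioi (a := -c) (by linarith) 0
  have hi := integrableOn_exp_mul_Ioi (a := -c) (by linarith) 0
  have e : ∀ s : ℝ, -(s * c) = -c * s := fun s => by ring
  simp only [e]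
  rw [← ofReal_integral_eq_lintegral_ofReal hi (.of_forall fun z => (Real.exp_pos _).le), h]
  congr 1
  simp [neg_div_neg_eq]

/-- The function `1 / (1 + r^γ)` is dominated by a mixture, over `u`, of the Gaussians
`exp (-u r²)`: the mixture is a multiple of `(1 + r²)^(-γ/2)`. -/
theorem ofReal_one_div_one_add_rpow_le {γ : ℝ} (hγ : 0 < γ) {r : ℝ} (hr : 0 ≤ r) :
    ENNReal.ofReal (1 / (1 + r ^ γ)) ≤ ENNReal.ofReal (2 ^ (γ / 2) / Real.Gamma (γ / 2)) *
      ∫⁻ u in Ioi (0 : ℝ), ENNReal.ofReal (u ^ (γ / 2 - 1) * Real.exp (-u)) *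
        ENNReal.ofReal (Real.exp (-u * r ^ 2)) := by
  have hγ2 : 0 < γ / 2 := by positivity
  have h1 : 0 < 1 + r ^ 2 := by positivity
  have hG : 0 < Real.Gamma (γ / 2) := Real.Gamma_pos_of_pos hγ2
  have hint := Real.integral_rpow_mul_exp_neg_mul_Ioi hγ2 h1
  have hi : IntegrableOn (fun u : ℝ => u ^ (γ / 2 - 1) * Real.exp (-((1 + r ^ 2) * u)))
      (Ioi 0) := by
    by_contra hcon
    rw [integral_undef hcon] at hint
    have : 0 < (1 / (1 + r ^ 2)) ^ (γ / 2) * Real.Gamma (γ / 2) := by positivity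
    linarith
  have heq : ∫⁻ u in Ioi (0 : ℝ), ENNReal.ofReal (u ^ (γ / 2 - 1) * Real.exp (-u)) *
        ENNReal.ofReal (Real.exp (-u * r ^ 2)) =
      ENNReal.ofReal ((1 / (1 + r ^ 2)) ^ (γ / 2) * Real.Gamma (γ / 2)) := by
    rw [← hint, ofReal_integral_eq_lintegral_ofReal hi
      ((ae_restrict_iff' measurableSet_Ioi).2 (.of_forall fun u (hu : 0 < u) => by positivity))]
    refine setLIntegral_congr_fun measurableSet_Ioi fun u (hu : 0 < u) => ?_
    rw [← ENNReal.ofReal_mul (by positivity), mul_assoc, ← Real.exp_add]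
    congr 3
    ring
  rw [heq, ← ENNReal.ofReal_mul (by positivity)]
  refine ENNReal.ofReal_le_ofReal ?_
  have hrw : 2 ^ (γ / 2) / Real.Gamma (γ / 2) * ((1 / (1 + r ^ 2)) ^ (γ / 2) *
      Real.Gamma (γ / 2)) = 2 ^ (γ / 2) / (1 + r ^ 2) ^ (γ / 2) := by
    rw [Real.div_rpow zero_le_one h1.le, Real.one_rpow]
    field_simp
  rw [hrw, div_le_div_iff₀ (by positivity) (by positivity), one_mul]
  have hm : 1 + r ^ 2 ≤ 2 * (max 1 r) ^ 2 := by
    have h1 : (1 : ℝ) ≤ max 1 r := le_max_left _ _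
    have h2 : r ≤ max 1 r := le_max_right _ _
    nlinarith
  have hmax : (max 1 r) ^ γ ≤ 1 + r ^ γ := by
    rcases le_total r 1 with h | h
    · rw [max_eq_left h, Real.one_rpow]; linarith [Real.rpow_nonneg hr γ]
    · rw [max_eq_right h]; linarith
  calc (1 + r ^ 2) ^ (γ / 2) ≤ (2 * (max 1 r) ^ 2) ^ (γ / 2) :=
        Real.rpow_le_rpow h1.le hm hγ2.le
    _ = 2 ^ (γ / 2) * (max 1 r) ^ γ := by
        rw [Real.mul_rpow (by norm_num) (by positivity), ← Real.rpow_natCast,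
          ← Real.rpow_mul (by positivity)]
        congr 2
        push_cast
        ring
    _ ≤ 2 ^ (γ / 2) * (1 + r ^ γ) := by gcongr

/-! ### The potential of the intensity under the stable semigroup -/

/-- Up to a constant factor, a bound on the density at time `s` of the intensity transported by the
stable semigroup, uniform in space: the bound of `lintegral_gaussian_le_charFun` for the stable law,
integrated over the Gaussian mixture of `ofReal_one_div_one_add_rpow_le`. -/
noncomputable def occupationBound (d : ℕ) (α γ s : ℝ) : ℝ≥0∞ :=
  ∫⁻ u in Ioi (0 : ℝ), ENNReal.ofReal (u ^ (γ / 2 - 1) * Real.exp (-u)) *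
    ∫⁻ v : EuclideanSpace ℝ (Fin d), ENNReal.ofReal (Real.exp (-‖v‖ ^ 2 / 4)) *
      ENNReal.ofReal (Real.exp (-(s * (√u * ‖v‖) ^ α)))

theorem lintegral_occupationBound_lt_top {d : ℕ} {α γ : ℝ} (hα : 0 < α) (hαd : α < d)
    (hαγ : α < γ) : ∫⁻ s in Ioi (0 : ℝ), occupationBound d α γ s < ∞ := by
  have hd : 0 < d := by exact_mod_cast hα.trans hαd
  have : Nonempty (Fin d) := ⟨⟨0, hd⟩⟩
  have hfin := lintegral_gaussian_mul_norm_rpow_neg_lt_top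
    (E := EuclideanSpace ℝ (Fin d)) (α := α) (by simpa using hαd)
  set I := ∫⁻ v : EuclideanSpace ℝ (Fin d),
    ENNReal.ofReal (Real.exp (-‖v‖ ^ 2 / 4) * ‖v‖ ^ (-α)) with hI
  -- Integrating in `s` first turns `exp (-s (√u |v|)^α)` into `u^(-α/2) |v|^(-α)`.
  have hinner : ∀ u : ℝ, 0 < u → ∫⁻ s in Ioi (0 : ℝ), ∫⁻ v : EuclideanSpace ℝ (Fin d),
      ENNReal.ofReal (Real.exp (-‖v‖ ^ 2 / 4)) *
        ENNReal.ofReal (Real.exp (-(s * (√u * ‖v‖) ^ α))) =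
      ENNReal.ofReal (u ^ (-(α / 2))) * I := by
    intro u hu
    rw [lintegral_lintegral_swap (by fun_prop), hI, ← lintegral_const_mul _ (by fun_prop)]
    refine lintegral_congr_ae ?_
    filter_upwards [Measure.ae_ne volume (0 : EuclideanSpace ℝ (Fin d))] with v hv
    have hv0 : 0 < ‖v‖ := norm_pos_iff.2 hv
    rw [lintegral_const_mul _ (by fun_prop), lintegral_exp_neg_mul_Ioi (by positivity),
      ← ENNReal.ofReal_mul (by positivity), ← ENNReal.ofReal_mul (by positivity)]
    congr 1
    rw [Real.mul_rpow (by positivity) (by positivity), mul_inv, Real.sqrt_eq_rpow,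
      ← Real.rpow_mul hu.le, ← Real.rpow_neg hu.le, ← Real.rpow_neg hv0.le,
      show -(1 / 2 * α) = -(α / 2) by ring]
    ring
  have hmeas : Measurable (fun p : ℝ × ℝ => ∫⁻ v : EuclideanSpace ℝ (Fin d),
      ENNReal.ofReal (Real.exp (-‖v‖ ^ 2 / 4)) *
        ENNReal.ofReal (Real.exp (-(p.1 * (√p.2 * ‖v‖) ^ α)))) :=
    Measurable.lintegral_prod_right' (f := fun q : (ℝ × ℝ) × EuclideanSpace ℝ (Fin d) =>
      ENNReal.ofReal (Real.exp (-‖q.2‖ ^ 2 / 4)) *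
        ENNReal.ofReal (Real.exp (-(q.1.1 * (√q.1.2 * ‖q.2‖) ^ α)))) (by fun_prop)
  unfold occupationBound
  rw [lintegral_lintegral_swap]
  swap
  · refine Measurable.aemeasurable ?_
    refine Measurable.mul ?_ hmeas
    fun_prop
  have hstep : ∫⁻ u in Ioi (0 : ℝ), ∫⁻ s in Ioi (0 : ℝ),
      ENNReal.ofReal (u ^ (γ / 2 - 1) * Real.exp (-u)) * ∫⁻ v : EuclideanSpace ℝ (Fin d),
        ENNReal.ofReal (Real.exp (-‖v‖ ^ 2 / 4)) *
        ENNReal.ofReal (Real.exp (-(s * (√u * ‖v‖) ^ α))) =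
      ∫⁻ u in Ioi (0 : ℝ), ENNReal.ofReal (Real.exp (-u) * u ^ ((γ - α) / 2 - 1)) * I := by
    refine setLIntegral_congr_fun measurableSet_Ioi fun u (hu : 0 < u) => ?_
    rw [lintegral_const_mul' _ _ ENNReal.ofReal_ne_top,
      hinner u hu, ← mul_assoc, ← ENNReal.ofReal_mul (by positivity)]
    congr 2
    rw [show (γ - α) / 2 - 1 = (γ / 2 - 1) + -(α / 2) by ring, Real.rpow_add hu]
    ring
  rw [hstep, lintegral_mul_const _ (by fun_prop)]
  refine ENNReal.mul_lt_top ?_ hfin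
  have hg := Real.GammaIntegral_convergent (s := (γ - α) / 2) (by linarith)
  exact (hasFiniteIntegral_iff_ofReal ((ae_restrict_iff' measurableSet_Ioi).2
    (.of_forall fun u (hu : 0 < u) => by positivity))).1 hg.2

/-- If `μ` is the law at time `s` of a standard stable process, the intensity transported by `μ`
has a density that is bounded, uniformly in space, by a multiple of `occupationBound`. -/
theorem lintegral_intensity_lintegral_add_le {d : ℕ} {α γ s : ℝ} (hγ : 0 < γ)
    (μ : Measure (EuclideanSpace ℝ (Fin d))) [IsProbabilityMeasure μ]
    (hμ : ∀ z, charFun μ z = Complex.exp (-((s : ℂ) * ((‖z‖ ^ α : ℝ) : ℂ))))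
    {f : EuclideanSpace ℝ (Fin d) → ℝ≥0∞} (hf : Measurable f) :
    ∫⁻ x, ∫⁻ z, f (x + z) ∂μ ∂(intensity d γ) ≤
      (ENNReal.ofReal (2 ^ (γ / 2) / Real.Gamma (γ / 2)) *
        (ENNReal.ofReal (∫ v : EuclideanSpace ℝ (Fin d), Real.exp (-‖v‖ ^ 2 / 4)))⁻¹ *
        ∫⁻ y, f y) * occupationBound d α γ s := by
  set h : EuclideanSpace ℝ (Fin d) → ℝ≥0∞ :=
    fun x => ENNReal.ofReal (1 / (1 + ‖x‖ ^ γ))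
  have hhm : Measurable h := by fun_prop
  set A := ENNReal.ofReal (2 ^ (γ / 2) / Real.Gamma (γ / 2))
  set c := ∫ v : EuclideanSpace ℝ (Fin d), Real.exp (-‖v‖ ^ 2 / 4)
  have hc0 : 0 < c := integral_exp_neg_quarter_norm_sq_pos
  have hc1 : ENNReal.ofReal c ≠ 0 := by simpa using hc0
  have hc2 : ENNReal.ofReal c ≠ ∞ := ENNReal.ofReal_ne_top
  have hfadd : Measurable (fun p : EuclideanSpace ℝ (Fin d) × EuclideanSpace ℝ (Fin d) =>
    f (p.1 + p.2)) := hf.comp measurable_add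
  -- Invariance of Lebesgue measure moves the displacement from `f` to the density `h`.
  have hdual : ∫⁻ x, ∫⁻ z, f (x + z) ∂μ ∂(intensity d γ) =
      ∫⁻ y, f y * ∫⁻ z, h (y - z) ∂μ := by
    rw [intensity, lintegral_withDensity_eq_lintegral_mul _ hhm hfadd.lintegral_prod_right']
    have e1 : ∀ x, (h * fun x => ∫⁻ z, f (x + z) ∂μ) x = ∫⁻ z, h x * f (x + z) ∂μ := fun x =>
      (lintegral_const_mul _ (hf.comp (measurable_const_add x))).symm
    simp_rw [e1]
    rw [lintegral_lintegral_swap (Measurable.aemeasurable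
      ((hhm.comp measurable_fst).mul hfadd))]
    have e2 : ∀ z, ∫⁻ x, h x * f (x + z) = ∫⁻ y, h (y - z) * f y := fun z => by
      rw [← lintegral_add_right_eq_self (fun y => h (y - z) * f y) z]
      simp
    simp_rw [e2]
    rw [lintegral_lintegral_swap (Measurable.aemeasurable
      ((hhm.comp (measurable_snd.sub measurable_fst)).mul (hf.comp measurable_snd)))]
    refine lintegral_congr fun y => ?_
    exact (lintegral_mul_const _ (hhm.comp (measurable_const_sub y))).trans (mul_comm _ _)
  have hgauss : ∀ u : ℝ, 0 < u → ∀ y : EuclideanSpace ℝ (Fin d),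
      ∫⁻ z, ENNReal.ofReal (Real.exp (-u * ‖y - z‖ ^ 2)) ∂μ ≤ (ENNReal.ofReal c)⁻¹ *
        ∫⁻ v : EuclideanSpace ℝ (Fin d), ENNReal.ofReal (Real.exp (-‖v‖ ^ 2 / 4)) *
          ENNReal.ofReal (Real.exp (-(s * (√u * ‖v‖) ^ α))) := by
    intro u hu y
    have hb := lintegral_gaussian_le_charFun μ hu.le y
    have e : ∀ v : EuclideanSpace ℝ (Fin d), ‖charFun μ (-(√u • v))‖ₑ =
        ENNReal.ofReal (Real.exp (-(s * (√u * ‖v‖) ^ α))) := fun v => by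
      rw [hμ, norm_neg, norm_smul, Real.norm_of_nonneg (Real.sqrt_nonneg u),
        ← ofReal_norm, Complex.norm_exp, ← Complex.ofReal_mul, ← Complex.ofReal_neg,
        Complex.ofReal_re]
    simp_rw [e] at hb
    rw [mul_comm, ← div_eq_mul_inv, ENNReal.le_div_iff_mul_le (.inl hc1) (.inl hc2), mul_comm]
    exact hb
  have hpot : ∀ y, ∫⁻ z, h (y - z) ∂μ ≤ A * (ENNReal.ofReal c)⁻¹ * occupationBound d α γ s := by
    intro y
    calc ∫⁻ z, h (y - z) ∂μ
        ≤ ∫⁻ z, A * (∫⁻ u in Ioi (0 : ℝ), ENNReal.ofReal (u ^ (γ / 2 - 1) * Real.exp (-u)) *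
            ENNReal.ofReal (Real.exp (-u * ‖y - z‖ ^ 2))) ∂μ :=
          lintegral_mono fun z => ofReal_one_div_one_add_rpow_le hγ (norm_nonneg _)
      _ = A * ∫⁻ u in Ioi (0 : ℝ), ENNReal.ofReal (u ^ (γ / 2 - 1) * Real.exp (-u)) *
            ∫⁻ z, ENNReal.ofReal (Real.exp (-u * ‖y - z‖ ^ 2)) ∂μ := by
          rw [lintegral_const_mul' _ _ ENNReal.ofReal_ne_top,
            lintegral_lintegral_swap (by fun_prop)]
          congr 1
          refine lintegral_congr fun u => ?_
          rw [lintegral_const_mul' _ _ ENNReal.ofReal_ne_top]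
      _ ≤ A * ∫⁻ u in Ioi (0 : ℝ), (ENNReal.ofReal c)⁻¹ *
            (ENNReal.ofReal (u ^ (γ / 2 - 1) * Real.exp (-u)) *
            ∫⁻ v : EuclideanSpace ℝ (Fin d), ENNReal.ofReal (Real.exp (-‖v‖ ^ 2 / 4)) *
              ENNReal.ofReal (Real.exp (-(s * (√u * ‖v‖) ^ α)))) := by
          refine mul_le_mul_right (setLIntegral_mono' measurableSet_Ioi fun u hu => ?_) _
          rw [mul_left_comm]
          exact mul_le_mul_right (hgauss u hu y) _
      _ = A * (ENNReal.ofReal c)⁻¹ * occupationBound d α γ s := by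
          rw [lintegral_const_mul' _ _ (ENNReal.inv_ne_top.2 hc1), occupationBound, mul_assoc]
  rw [hdual]
  calc ∫⁻ y, f y * ∫⁻ z, h (y - z) ∂μ
      ≤ ∫⁻ y, f y * (A * (ENNReal.ofReal c)⁻¹ * occupationBound d α γ s) :=
        lintegral_mono fun y => mul_le_mul_right (hpot y) _
    _ = _ := by rw [lintegral_mul_const _ hf]; ring

/-! ### Mean measure of a Poisson point measure -/

theorem lintegral_natCast_poissonMeasure (r : ℝ≥0) :
    ∫⁻ n : ℕ, (n : ℝ≥0∞) ∂(poissonMeasure r) = r := by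
  have hterm : ∀ n : ℕ, 0 ≤ Real.exp (-r) * (r : ℝ) ^ n / (n.factorial : ℝ) := fun n => by positivity
  have hone : ∑' n : ℕ, ENNReal.ofReal (Real.exp (-r) * (r : ℝ) ^ n / (n.factorial : ℝ)) = 1 := by
    rw [← ENNReal.ofReal_tsum_of_nonneg hterm (hasSum_one_poissonMeasure r).summable,
      (hasSum_one_poissonMeasure r).tsum_eq, ENNReal.ofReal_one]
  rw [poissonMeasure, lintegral_sum_measure]
  simp only [lintegral_smul_measure, lintegral_dirac, smul_eq_mul]
  rw [tsum_eq_zero_add' ENNReal.summable, Nat.cast_zero, mul_zero, zero_add]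
  have hsucc : ∀ n : ℕ, ENNReal.ofReal (Real.exp (-r) * (r : ℝ) ^ (n + 1) /
      ((n + 1).factorial : ℝ)) * ((n + 1 : ℕ) : ℝ≥0∞) =
      r * ENNReal.ofReal (Real.exp (-r) * (r : ℝ) ^ n / (n.factorial : ℝ)) := fun n => by
    rw [← ENNReal.ofReal_natCast, ← ENNReal.ofReal_mul (hterm _), ← ENNReal.ofReal_coe_nnreal,
      ← ENNReal.ofReal_mul r.coe_nonneg]
    congr 1
    rw [Nat.factorial_succ]
    push_cast
    field_simp
    ring
  simp_rw [hsucc]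
  rw [ENNReal.tsum_mul_left, hone, mul_one]

/-- Campbell's formula for the mean of a Poisson point measure. -/
theorem IsPoissonPointMeasure.lintegral_lintegral {Ω E : Type*} [MeasurableSpace Ω]
    [MeasurableSpace E] {M : Ω → Measure E} {ν : Measure E} [SigmaFinite ν] {P : Measure Ω}
    (hM : IsPoissonPointMeasure M ν P) {f : E → ℝ≥0∞} (hf : Measurable f) :
    ∫⁻ ω, ∫⁻ x, f x ∂(M ω) ∂P = ∫⁻ x, f x ∂ν := by
  -- `ν` may be infinite, so `P.bind M` is compared with it on sets of finite intensity first.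
  have hfin : ∀ B, MeasurableSet B → ν B ≠ ∞ → P.bind M B = ν B := fun B hB hνB => by
    rw [Measure.bind_apply hB hM.measurable.aemeasurable,
      (hM.poisson B hB hνB).lintegral_comp (f := fun x => x) aemeasurable_id,
      lintegral_map (f := fun x => x) measurable_id .of_discrete]
    exact (lintegral_natCast_poissonMeasure _).trans (ENNReal.coe_toNNReal hνB)
  have heq : P.bind M = ν := by
    refine Measure.ext_of_generateFrom_of_iUnion
      {s | MeasurableSet s ∧ ν s ≠ ∞} (spanningSets ν) ?_ ?_ (iUnion_spanningSets ν) ?_ ?_ ?_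
    · refine le_antisymm (fun s hs => ?_) (MeasurableSpace.generateFrom_le fun s hs => hs.1)
      rw [← inter_univ s, ← iUnion_spanningSets ν, inter_iUnion]
      refine MeasurableSet.iUnion fun n => MeasurableSpace.measurableSet_generateFrom
        ⟨hs.inter (measurableSet_spanningSets ν n), ?_⟩
      exact ne_top_of_le_ne_top (measure_spanningSets_lt_top ν n).ne (measure_mono inter_subset_right)
    · rintro s ⟨hs, hs'⟩ t ⟨ht, -⟩ -
      exact ⟨hs.inter ht, ne_top_of_le_ne_top hs' (measure_mono inter_subset_left)⟩
    · exact fun n => ⟨measurableSet_spanningSets ν n, (measure_spanningSets_lt_top ν n).ne⟩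
    · intro n
      rw [hfin _ (measurableSet_spanningSets ν n) (measure_spanningSets_lt_top ν n).ne]
      exact (measure_spanningSets_lt_top ν n).ne
    · exact fun s hs => hfin s hs.1 hs.2
  rw [← heq, Measure.lintegral_bind hM.measurable.aemeasurable hf.aemeasurable]

instance sigmaFinite_intensity (d : ℕ) (γ : ℝ) : SigmaFinite (intensity d γ) := by
  unfold intensity
  exact SigmaFinite.withDensity_ofReal _

/-! ### The empirical measures of the particle system -/

theorem lintegral_pointSum {E : Type*} [MeasurableSpace E] (K : ℕ∞) (x : ℕ → E) {f : E → ℝ≥0∞}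
    (hf : Measurable f) :
    ∫⁻ y, f y ∂(pointSum K x) = ∑' i : ℕ, {i : ℕ | (i : ℕ∞) < K}.indicator (fun i => f (x i)) i := by
  rw [pointSum, lintegral_sum_measure]
  simp only [lintegral_dirac' _ hf]
  exact tsum_subtype {i : ℕ | (i : ℕ∞) < K} fun i => f (x i)

section System

variable {Ω : Type*} [MeasurableSpace Ω] {d : ℕ} {α : ℝ} {P : Measure Ω}

/-- Right-continuity makes a process, observed at the later times `(⌊(n+1)t⌋+1)/(n+1)`,
converge to its value at `t`; hence joint measurability in time and chance. -/
theorem IsStandardStableProcess.aemeasurable_uncurry [IsProbabilityMeasure P]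
    {Z : ℝ≥0 → Ω → EuclideanSpace ℝ (Fin d)}
    (hZ : IsStandardStableProcess α Z P) (ρ : Measure ℝ) [SFinite ρ] :
    AEMeasurable (fun p : Ω × ℝ => Z p.2.toNNReal p.1) (P.prod ρ) := by
  let τ : ℕ → ℝ≥0 → ℝ≥0 := fun n t => ((⌊((n : ℝ≥0) + 1) * t⌋₊ + 1 : ℕ) : ℝ≥0) / ((n : ℝ≥0) + 1)
  have hτ : ∀ t, Tendsto (fun n => τ n t) atTop (𝓝[Ici t] t) := fun t => by
    -- The approximating times lie in `[t, t + 1 / (n + 1)]`, so only right limits are used.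
    have hlow : ∀ n, t ≤ τ n t := fun n => by
      rw [le_div_iff₀ (by positivity), mul_comm]
      push_cast
      exact (Nat.lt_floor_add_one _).le
    have hup : ∀ n, τ n t ≤ t + 1 / ((n : ℝ≥0) + 1) := fun n => by
      rw [div_le_iff₀ (by positivity), add_mul t, one_div, inv_mul_cancel₀ (by positivity)]
      push_cast
      rw [mul_comm t]
      gcongr
      exact Nat.floor_le (by positivity)
    refine tendsto_nhdsWithin_of_tendsto_nhds_of_eventually_within _ ?_ (.of_forall hlow)
    refine tendsto_of_tendsto_of_tendsto_of_le_of_le tendsto_const_nhds ?_ hlow hup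
    simpa using (tendsto_one_div_add_atTop_nhds_zero_nat (𝕜 := ℝ≥0)).const_add t
  refine aemeasurable_of_tendsto_metrizable_ae'
    (f := fun n p => Z (τ n p.2.toNNReal) p.1) (fun n => Measurable.aemeasurable ?_) ?_
  · have h1 : Measurable (fun q : Ω × ℕ => Z ((q.2 : ℝ≥0) / ((n : ℝ≥0) + 1)) q.1) :=
      measurable_from_prod_countable_left fun k =>
        show Measurable (Z ((k : ℝ≥0) / ((n : ℝ≥0) + 1))) from hZ.measurable _
    have h2 : Measurable (fun p : Ω × ℝ =>
        (p.1, ⌊((n : ℝ≥0) + 1) * p.2.toNNReal⌋₊ + 1)) := by fun_prop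
    exact h1.comp h2
  · filter_upwards [Measure.quasiMeasurePreserving_fst.ae hZ.cadlag] with p hp
    exact ((hp p.2.toNNReal).1.tendsto).comp (hτ _)

variable {ν : Measure (EuclideanSpace ℝ (Fin d))}
  {K : Ω → ℕ∞} {X : ℕ → Ω → EuclideanSpace ℝ (Fin d)}
  {Z : ℕ → ℝ≥0 → Ω → EuclideanSpace ℝ (Fin d)}

theorem measurableSet_lt_number (hK : Measurable K) (i : ℕ) :
    MeasurableSet {ω | (i : ℕ∞) < K ω} :=
  hK (MeasurableSet.of_discrete (s := Ioi (i : ℕ∞)))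

theorem IsStableParticleSystem.aemeasurable_lintegral [IsProbabilityMeasure P]
    (hsys : IsStableParticleSystem α ν K X Z P) (ρ : Measure ℝ) [SFinite ρ]
    {f : EuclideanSpace ℝ (Fin d) → ℝ≥0∞} (hf : Measurable f) :
    AEMeasurable (fun p : Ω × ℝ => ∫⁻ x, f x ∂(empiricalProcess K X Z p.2.toNNReal p.1))
      (P.prod ρ) := by
  simp only [empiricalProcess, lintegral_pointSum _ _ hf]
  refine AEMeasurable.tsum fun i => ?_
  have h : AEMeasurable (fun p : Ω × ℝ => f (X i p.1 + Z i p.2.toNNReal p.1)) (P.prod ρ) :=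
    hf.comp_aemeasurable ((((hsys.measurable_start i).comp measurable_fst).aemeasurable).add
      ((hsys.stable i).aemeasurable_uncurry ρ))
  exact h.indicator (measurable_fst (measurableSet_lt_number hsys.measurable_number i))

/-- The mean of the empirical measure at a fixed time is the intensity transported by the stable
semigroup: Campbell's formula for the starting points, and independence of the motions from
them. -/
theorem IsStableParticleSystem.lintegral_lintegral [IsProbabilityMeasure P] [SigmaFinite ν]
    (hsys : IsStableParticleSystem α ν K X Z P) (t : ℝ≥0)
    {f : EuclideanSpace ℝ (Fin d) → ℝ≥0∞} (hf : Measurable f) :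
    ∫⁻ ω, ∫⁻ x, f x ∂(empiricalProcess K X Z t ω) ∂P =
      ∫⁻ x, ∫⁻ z, f (x + z) ∂(P.map (Z 0 t)) ∂ν := by
  have hprob : ∀ i, IsProbabilityMeasure (P.map (Z i t)) := fun i =>
    Measure.isProbabilityMeasure_map ((hsys.stable i).measurable t).aemeasurable
  -- The law of the displacement is the same for all particles, having the same Fourier transform.
  have hlaw : ∀ i, P.map (Z i t) = P.map (Z 0 t) := fun i =>
    Measure.ext_of_charFun (funext fun z => by
      rw [(hsys.stable i).charFun_eq, (hsys.stable 0).charFun_eq])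
  set μ := P.map (Z 0 t)
  have hfadd : Measurable (fun p : EuclideanSpace ℝ (Fin d) × EuclideanSpace ℝ (Fin d) =>
    f (p.1 + p.2)) := hf.comp measurable_add
  have hg : Measurable (fun x => ∫⁻ z, f (x + z) ∂μ) := hfadd.lintegral_prod_right'
  have hK := measurableSet_lt_number hsys.measurable_number
  have hterm : ∀ i : ℕ, ∫⁻ ω, {ω | (i : ℕ∞) < K ω}.indicator (fun ω => f (X i ω + Z i t ω)) ω ∂P =
      ∫⁻ ω, {ω | (i : ℕ∞) < K ω}.indicator (fun ω => ∫⁻ z, f (X i ω + z) ∂μ) ω ∂P := fun i => by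
    have hind : IndepFun (fun ω => (K ω, X i ω)) (Z i t) P :=
      hsys.indep_start.comp
        (φ := fun q : ℕ∞ × (ℕ → EuclideanSpace ℝ (Fin d)) => (q.1, q.2 i))
        (ψ := fun w : ℕ → ℝ≥0 → EuclideanSpace ℝ (Fin d) => w i t) (by fun_prop) (by fun_prop)
    have hKX : Measurable (fun ω => (K ω, X i ω)) :=
      hsys.measurable_number.prodMk (hsys.measurable_start i)
    have hZm : Measurable (Z i t) := (hsys.stable i).measurable t
    have hmap := (indepFun_iff_map_prod_eq_prod_map_map hKX.aemeasurable hZm.aemeasurable).1 hind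
    rw [hlaw i] at hmap
    have hS : MeasurableSet {q : ℕ∞ × EuclideanSpace ℝ (Fin d) | (i : ℕ∞) < q.1} :=
      measurable_fst (MeasurableSet.of_discrete (s := Ioi (i : ℕ∞)))
    have hG : Measurable (fun r : (ℕ∞ × EuclideanSpace ℝ (Fin d)) × EuclideanSpace ℝ (Fin d) =>
        {q : ℕ∞ × EuclideanSpace ℝ (Fin d) | (i : ℕ∞) < q.1}.indicator
          (fun q => f (q.2 + r.2)) r.1) :=
      (hf.comp ((measurable_snd.comp measurable_fst).add measurable_snd)).indicator
        (measurable_fst hS)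
    calc ∫⁻ ω, {ω | (i : ℕ∞) < K ω}.indicator (fun ω => f (X i ω + Z i t ω)) ω ∂P
        = ∫⁻ r, {q : ℕ∞ × EuclideanSpace ℝ (Fin d) | (i : ℕ∞) < q.1}.indicator
          (fun q => f (q.2 + r.2)) r.1 ∂(P.map fun ω => ((K ω, X i ω), Z i t ω)) := by
          rw [lintegral_map hG (hKX.prodMk hZm)]
          rfl
      _ = ∫⁻ ω, ∫⁻ z, {q : ℕ∞ × EuclideanSpace ℝ (Fin d) | (i : ℕ∞) < q.1}.indicator
          (fun q => f (q.2 + z)) (K ω, X i ω) ∂μ ∂P := by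
          rw [hmap, lintegral_prod _ hG.aemeasurable, lintegral_map hG.lintegral_prod_right' hKX]
      _ = _ := by
          refine lintegral_congr fun ω => ?_
          by_cases h : (i : ℕ∞) < K ω <;> simp [indicator, h]
  have hcamp := hsys.poisson_start.lintegral_lintegral hg
  simp only [lintegral_pointSum _ _ hg] at hcamp
  rw [← hcamp]
  simp only [empiricalProcess, lintegral_pointSum _ _ hf]
  rw [lintegral_tsum, lintegral_tsum]
  · exact tsum_congr hterm
  · exact fun i => ((hg.comp (hsys.measurable_start i)).indicator (hK i)).aemeasurable
  · exact fun i => ((hf.comp ((hsys.measurable_start i).add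
      ((hsys.stable i).measurable t))).indicator (hK i)).aemeasurable

/-- The expected total occupation time of a nonnegative integrable function is finite. -/
theorem IsStableParticleSystem.lintegral_occupation_lt_top [IsProbabilityMeasure P] {γ : ℝ}
    (hα0 : 0 < α) (hαd : α < d) (hαγ : α < γ)
    (hsys : IsStableParticleSystem α (intensity d γ) K X Z P)
    {f : EuclideanSpace ℝ (Fin d) → ℝ≥0∞} (hf : Measurable f) (hfi : ∫⁻ x, f x ≠ ∞) :
    ∫⁻ ω, ∫⁻ s in Ioi (0 : ℝ), ∫⁻ x, f x ∂(empiricalProcess K X Z s.toNNReal ω) ∂volume ∂P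
      < ∞ := by
  rw [lintegral_lintegral_swap (hsys.aemeasurable_lintegral _ hf)]
  simp only [hsys.lintegral_lintegral _ hf]
  set C := ENNReal.ofReal (2 ^ (γ / 2) / Real.Gamma (γ / 2)) *
    (ENNReal.ofReal (∫ v : EuclideanSpace ℝ (Fin d), Real.exp (-‖v‖ ^ 2 / 4)))⁻¹ *
    ∫⁻ y, f y
  have hCtop : C ≠ ∞ := by
    refine ENNReal.mul_ne_top (ENNReal.mul_ne_top ENNReal.ofReal_ne_top
      (ENNReal.inv_ne_top.2 ?_)) hfi
    simpa using integral_exp_neg_quarter_norm_sq_pos (E := EuclideanSpace ℝ (Fin d))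
  calc ∫⁻ s in Ioi (0 : ℝ), ∫⁻ x, ∫⁻ z, f (x + z) ∂(P.map (Z 0 s.toNNReal)) ∂(intensity d γ)
      ≤ ∫⁻ s in Ioi (0 : ℝ), C * occupationBound d α γ s := by
        refine setLIntegral_mono' measurableSet_Ioi fun s (hs : 0 < s) => ?_
        have : IsProbabilityMeasure (P.map (Z 0 s.toNNReal)) :=
          Measure.isProbabilityMeasure_map ((hsys.stable 0).measurable _).aemeasurable
        refine lintegral_intensity_lintegral_add_le (hα0.trans hαγ) _ (fun z => ?_) hf
        rw [(hsys.stable 0).charFun_eq, Real.coe_toNNReal s hs.le]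
    _ = C * ∫⁻ s in Ioi (0 : ℝ), occupationBound d α γ s := lintegral_const_mul' _ _ hCtop
    _ < ∞ := ENNReal.mul_lt_top hCtop.lt_top (lintegral_occupationBound_lt_top hα0 hαd hαγ)

end System

/-! ### Absolute convergence of the occupation time -/

/-- The first two clauses say that `E ∫_0^∞ ⟨N_s, |φ|⟩ ds` is a well-defined finite number; the last
three say that every integral in `E ∫_0^∞ ⟨N_s, φ⟩ ds` converges absolutely. -/
theorem proposition2p6 (d : ℕ) (α γ : ℝ) (hα0 : 0 < α) (hα2 : α ≤ 2)
    (hαd : α < d) (hαγ : α < γ)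
    {Ω : Type*} [MeasurableSpace Ω] (P : Measure Ω) [IsProbabilityMeasure P]
    (K : Ω → ℕ∞) (X : ℕ → Ω → EuclideanSpace ℝ (Fin d))
    (Z : ℕ → ℝ≥0 → Ω → EuclideanSpace ℝ (Fin d))
    (hsys : IsStableParticleSystem α (intensity d γ) K X Z P)
    (φ : 𝓢(EuclideanSpace ℝ (Fin d), ℝ)) :
    AEMeasurable
        (fun p : Ω × ℝ => ∫⁻ x, ‖φ x‖ₑ ∂(empiricalProcess K X Z p.2.toNNReal p.1))
        (P.prod (volume.restrict (Ioi (0 : ℝ)))) ∧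
      (∫⁻ ω, ∫⁻ s in Ioi (0 : ℝ),
          ∫⁻ x, ‖φ x‖ₑ ∂(empiricalProcess K X Z s.toNNReal ω) ∂volume ∂P) < ∞ ∧
      (∀ᵐ ω ∂P, ∀ᵐ s ∂(volume.restrict (Ioi (0 : ℝ))),
        Integrable φ (empiricalProcess K X Z s.toNNReal ω)) ∧
      (∀ᵐ ω ∂P, IntegrableOn
        (fun s : ℝ => ∫ x, φ x ∂(empiricalProcess K X Z s.toNNReal ω)) (Ioi (0 : ℝ))) ∧
      Integrable
        (fun ω => ∫ s in Ioi (0 : ℝ), ∫ x, φ x ∂(empiricalProcess K X Z s.toNNReal ω)) P := by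
  have hφ : Continuous φ := φ.continuous
  have hmeas := hsys.aemeasurable_lintegral (volume.restrict (Ioi (0 : ℝ)))
    (f := fun x => ‖φ x‖ₑ) (by fun_prop)
  have hfin := hsys.lintegral_occupation_lt_top hα0 hαd hαγ (f := fun x => ‖φ x‖ₑ) (by fun_prop)
    φ.integrable.2.ne
  have hprod : ∫⁻ p : Ω × ℝ, (∫⁻ x, ‖φ x‖ₑ ∂(empiricalProcess K X Z p.2.toNNReal p.1))
      ∂(P.prod (volume.restrict (Ioi (0 : ℝ)))) < ∞ := by
    rwa [lintegral_prod _ hmeas]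
  have hae : ∀ᵐ p ∂(P.prod (volume.restrict (Ioi (0 : ℝ)))),
      Integrable φ (empiricalProcess K X Z p.2.toNNReal p.1) := by
    filter_upwards [ae_lt_top' hmeas hprod.ne] with p hp
    exact ⟨hφ.aestronglyMeasurable, hp⟩
  have hsm : AEStronglyMeasurable
      (fun p : Ω × ℝ => ∫ x, φ x ∂(empiricalProcess K X Z p.2.toNNReal p.1))
      (P.prod (volume.restrict (Ioi (0 : ℝ)))) := by
    have hpos := hsys.aemeasurable_lintegral (volume.restrict (Ioi (0 : ℝ)))
      (f := fun x => ENNReal.ofReal (φ x)) (by fun_prop)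
    have hneg := hsys.aemeasurable_lintegral (volume.restrict (Ioi (0 : ℝ)))
      (f := fun x => ENNReal.ofReal (-φ x)) (by fun_prop)
    refine ((hpos.ennreal_toReal.sub hneg.ennreal_toReal).aestronglyMeasurable).congr ?_
    filter_upwards [hae] with p hp
    exact (integral_eq_lintegral_pos_part_sub_lintegral_neg_part hp).symm
  have hint : Integrable
      (fun p : Ω × ℝ => ∫ x, φ x ∂(empiricalProcess K X Z p.2.toNNReal p.1))
      (P.prod (volume.restrict (Ioi (0 : ℝ)))) :=
    ⟨hsm, (lintegral_mono fun p => enorm_integral_le_lintegral_enorm _).trans_lt hprod⟩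
  exact ⟨hmeas, hfin, Measure.ae_ae_of_ae_prod hae, hint.prod_right_ae, hint.integral_prod_left⟩
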